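/- Equip $\mathbb R^{4,2}=\mathbb R^4\times\mathbb R^2$ with the form $\langle y,z\rangle=y_1z_1+y_2z_2+y_3z_3+y_4z_4-y_5z_5-y_6z_6$, and let $\mathcal L=\{[y]\in P(\mathbb R^{4,2}) : \langle y,y\rangle=0\}$ be the Lie quadric. The oriented sphere of $S^3$ with centre $m\in S^3$ and spherical radius $r$ is the point $[m,\cos r,\sin r]\in\mathcal L$. The contact element of $S^3$ at $x\in S^3$ with unit normal $n\perp x$ is the line in $\mathcal L$ through $[x,1,0]$ and $[n,0,1]$, which consists of the oriented spheres through $x$ with normal $n$. A family of lines $\ell_{i,j}\subset\mathcal L$, $(i,j)\in\mathbb Z^2$, is a multi-line congruence if $\ell_{i_0,j_0}$ intersects $\ell_{i_1,j_0}$ and $\ell_{i_0,j_1}$ for all $i_0,i_1,j_0,j_1$. Call it generic if (a) for every $i$ the lines $\ell_{i,j}$ ($j\in\mathbb Z$), and for every $j$ the lines $\ell_{i,j}$ ($i\in\mathbb Z$), span a projective subspace of dimension at least three, and (b) for all $i,j$ there is no point that lies on all the lines $\ell_{i,j'}$ ($j'\in\mathbb Z$) and on all the lines $\ell_{i',j}$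 ($i'\in\mathbb Z$). A Dupin cyclide parametrized along its curvature lines is a pair of smooth maps $x,n:\mathbb R^2\to S^3$ such that: - $\langle x,n\rangle=0$ and $\langle dx,n\rangle=0$, and $(x,n)$ is an immersion (the map $x$ alone may have singularities); - $(x,n)$ takes the same value at two parameters if and only if these differ by an element of $(2\pi\mathbb Z)^2$, so that the contact elements form an embedded torus; - there are functions $r_1,r_2$ with $\cos r_1\,x_u+\sin r_1\,n_u=0$ and $\cos r_2\,x_v+\sin r_2\,n_v=0$ (the coordinate lines are curvature lines with principal radii $r_1,r_2$), with $r_1-r_2\notin\pi\mathbb Z$ everywhere, $r_1$ independent of $u$, and $r_2$ independent of $v$. **Theorem.** Every generic multi-line congruence $\ell$ in the Lie quadric consists of contact elements of a Dupin cyclide along its curvature lines: there are a Dupin cyclide $(x,n)$ parametrized along its curvature lines and sequences $(u_i)_{i\in\mathbb Z}$, $(v_j)_{j\in\mathbb Z}$ of real numbers such that, for all $i,j\in\mathbb Z$, the line $\ell_{i,j}$ is the contact element of $(x,n)$ at the parameter $(u_i,v_j)$. -/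

import Mathlib

open scoped ContDiff

noncomputable section

namespace LieSphere

/-- The Euclidean space containing the unit sphere `S³`. -/
abbrev E4 : Type := EuclideanSpace ℝ (Fin 4)

/-- The vector space of homogeneous coordinates, `ℝ^{4,2}`. -/
abbrev LieSpace : Type := E4 × ℝ × ℝ

/-- The standard bilinear form of signature `(4,2)`. -/
def lieForm (y z : LieSpace) : ℝ :=
  inner ℝ y.1 z.1 - y.2.1 * z.2.1 - y.2.2 * z.2.2

/-- A projective line (a two-dimensional linear subspace) contained in the Lie quadric
`{[y] | lieForm y y = 0}`, i.e. an isotropic line. -/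
def IsIsotropicLine (L : Submodule ℝ LieSpace) : Prop :=
  Module.finrank ℝ L = 2 ∧ ∀ y ∈ L, lieForm y y = 0

/-- Two projective subspaces intersect if they have a point of projective space in common. -/
def Intersects (L M : Submodule ℝ LieSpace) : Prop := L ⊓ M ≠ ⊥

/-- A multi-line congruence in the Lie quadric: any two lines along a common parameter line of
`ℤ²` intersect. -/
structure IsMultiLineCongruence (l : ℤ → ℤ → Submodule ℝ LieSpace) : Prop where
  isotropic : ∀ i j, IsIsotropicLine (l i j)
  intersects : ∀ i₀ i₁ j₀ j₁,
    Intersects (l i₀ j₀) (l i₁ j₀) ∧ Intersects (l i₀ j₀) (l i₀ j₁)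

/-- General position of a congruence: the lines along each parameter line span a projective
subspace of dimension at least three (linear dimension at least four), and no point of
projective space lies on all the lines of a parameter line of the first direction and also on
all the lines of a parameter line of the second direction. -/
structure IsGeneric (l : ℤ → ℤ → Submodule ℝ LieSpace) : Prop where
  span_snd : ∀ i, 4 ≤ Module.finrank ℝ (⨆ j, l i j : Submodule ℝ LieSpace)
  span_fst : ∀ j, 4 ≤ Module.finrank ℝ (⨆ i, l i j : Submodule ℝ LieSpace)
  no_common_point : ∀ i j, (⨅ j', l i j') ⊓ (⨅ i', l i' j) = ⊥

/-- Homogeneous coordinates of the oriented sphere of `S³` with centre `m ∈ S³` and signed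
spherical radius `r`. Radius `0` gives the point `m`; `(m, r)` and `(-m, r + π)` give the same
oriented sphere. -/
def orientedSphere (m : E4) (r : ℝ) : LieSpace := (m, Real.cos r, Real.sin r)

/-- The contact element of `S³` with base point `x` and unit normal `n`, as a line in the Lie
quadric: the pencil spanned by the point `x` and the oriented great sphere with pole `n`. It
consists of the oriented spheres with centre `cos r • x + sin r • n` and radius `r`, i.e. of those
that pass through `x` with unit normal `n`. -/
def contactElement (x n : E4) : Submodule ℝ LieSpace :=
  Submodule.span ℝ {orientedSphere x 0, orientedSphere n (Real.pi / 2)}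

/-- A parametrized surface of contact elements of `S³` (Legendre immersion): a point `x` and a
unit vector `n` tangent to `S³` at `x`, such that `n` is normal to the surface `x` and the pair
`(x, n)` is an immersion. The map `x` itself may be singular. -/
structure IsLegendreImmersion (x n : ℝ × ℝ → E4) : Prop where
  smooth_pt : ContDiff ℝ ∞ x
  smooth_normal : ContDiff ℝ ∞ n
  norm_pt : ∀ p, ‖x p‖ = 1
  norm_normal : ∀ p, ‖n p‖ = 1
  orthogonal : ∀ p, inner ℝ (x p) (n p) = 0
  contact : ∀ p w, inner ℝ (fderiv ℝ x p w) (n p) = 0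
  immersion : ∀ p w, fderiv ℝ x p w = 0 → fderiv ℝ n p w = 0 → w = 0

/-- The parameter direction `w ≠ 0` at `p` is a principal direction with principal radius of
curvature `r`: the centre `cos r • x + sin r • n` of the oriented sphere of radius `r` touching
the surface at `p` is stationary in the direction `w`. For an immersed surface `x` this is
Rodrigues' equation `dn(w) = -cot r • dx(w)`, and the sphere is the curvature sphere. -/
def IsPrincipal (x n : ℝ × ℝ → E4) (p w : ℝ × ℝ) (r : ℝ) : Prop :=
  w ≠ 0 ∧ Real.cos r • fderiv ℝ x p w + Real.sin r • fderiv ℝ n p w = 0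

/-- `(x, n)` is a Dupin cyclide (in the sense of Lie sphere geometry) parametrized along its
curvature lines: an embedded torus of contact elements of `S³`, doubly `2π`-periodic in the
parameters, whose coordinate lines are curvature lines, whose two curvature spheres are
everywhere distinct, and each of whose principal curvature radii is constant along the
corresponding curvature lines. -/
structure IsDupinCyclide (x n : ℝ × ℝ → E4) : Prop where
  legendre : IsLegendreImmersion x n
  torus : ∀ p q : ℝ × ℝ, (x p = x q ∧ n p = n q) ↔
    ∃ k m : ℤ, p = q + ((k : ℝ) * (2 * Real.pi), (m : ℝ) * (2 * Real.pi))
  dupin : ∃ r₁ r₂ : ℝ × ℝ → ℝ,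
    (∀ p, IsPrincipal x n p (1, 0) (r₁ p)) ∧
    (∀ p, IsPrincipal x n p (0, 1) (r₂ p)) ∧
    (∀ p, Real.sin (r₁ p - r₂ p) ≠ 0) ∧
    (∀ u u' v, r₁ (u, v) = r₁ (u', v)) ∧
    (∀ u v v', r₂ (u, v) = r₂ (u, v'))

end LieSphere

end

noncomputable section

namespace LieSphere

/-! ### The Lie form -/

/-! Signature (4,2) leaves no room for three independent, mutually orthogonal vectors of nonpositive
square. In particular there is no isotropic projective plane, so pairwise intersecting isotropic
lines that are not all equal are concurrent (`exists_common_point`). By (a) the lines with fixed `i`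
therefore share a point `p i`, and those with fixed `j` a point `q j`; by (b) these points differ,
so `l i j` is their join and `p i ⊥ q j`.

By (a) again, each of the two orthogonal families has rank at least three. This forces their spans
to be complementary subspaces of signature (2,1) (`exists_isLorentzFrame_of_finrank`). The light
cone of each is projectively a circle (`coneCircle`), one carrying all `p i`, the other all `q j`.

Joining every point `p(u)` of the first circle to every point `q(v)` of the second gives a torus of
contact elements. Since `q` does not move with `u`, nor `p` with `v`, these spheres are the
curvature spheres, each constant along its own curvature lines: a Dupin cyclide
(`isDupinCyclide_of_isConeCircle`). -/

theorem lieForm_comm (y z : LieSpace) : lieForm y z = lieForm z y := by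
  simp only [lieForm, real_inner_comm, mul_comm]

theorem lieForm_add_left (y y' z : LieSpace) :
    lieForm (y + y') z = lieForm y z + lieForm y' z := by
  simp only [lieForm, Prod.fst_add, Prod.snd_add, inner_add_left]; ring

theorem lieForm_smul_left (a : ℝ) (y z : LieSpace) : lieForm (a • y) z = a * lieForm y z := by
  simp only [lieForm, Prod.smul_fst, Prod.smul_snd, real_inner_smul_left, smul_eq_mul]; ring

theorem lieForm_add_right (y z z' : LieSpace) :
    lieForm y (z + z') = lieForm y z + lieForm y z' := by
  simp only [lieForm_comm y, lieForm_add_left]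

theorem lieForm_smul_right (a : ℝ) (y z : LieSpace) : lieForm y (a • z) = a * lieForm y z := by
  simp only [lieForm_comm y, lieForm_smul_left]

theorem lieForm_sub_left (y y' z : LieSpace) :
    lieForm (y - y') z = lieForm y z - lieForm y' z := by
  rw [sub_eq_add_neg, ← neg_one_smul ℝ, lieForm_add_left, lieForm_smul_left]; ring

theorem lieForm_sub_right (y z z' : LieSpace) :
    lieForm y (z - z') = lieForm y z - lieForm y z' := by
  simp only [lieForm_comm y, lieForm_sub_left]

theorem lieForm_zero_left (z : LieSpace) : lieForm 0 z = 0 := by simp [lieForm]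

theorem lieForm_zero_right (z : LieSpace) : lieForm z 0 = 0 := by simp [lieForm]

/-- The Lie form as a bilinear form. -/
def lieBilin : LinearMap.BilinForm ℝ LieSpace :=
  LinearMap.mk₂ ℝ lieForm lieForm_add_left lieForm_smul_left lieForm_add_right
    (fun a y z => lieForm_smul_right a y z)

theorem lieBilin_apply (y z : LieSpace) : lieBilin y z = lieForm y z := rfl

theorem eq_zero_of_lieForm_self_nonpos {y : LieSpace} (hy : lieForm y y ≤ 0) (h : y.2 = 0) :
    y = 0 := by
  have h1 : y.1 = 0 := by
    rw [lieForm, h] at hy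
    simpa using hy
  exact Prod.ext h1 h

theorem eq_zero_of_forall_lieForm {y : LieSpace} (h : ∀ z, lieForm y z = 0) : y = 0 := by
  have h1 := h (y.1, -y.2.1, -y.2.2)
  have h2 : (inner ℝ y.1 y.1 : ℝ) = ‖y.1‖ ^ 2 := real_inner_self_eq_norm_sq _
  simp only [lieForm, h2] at h1
  have a : ‖y.1‖ = 0 := by nlinarith [sq_nonneg ‖y.1‖, sq_nonneg y.2.1, sq_nonneg y.2.2]
  have b : y.2.1 = 0 := by nlinarith [sq_nonneg ‖y.1‖, sq_nonneg y.2.1, sq_nonneg y.2.2]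
  have c : y.2.2 = 0 := by nlinarith [sq_nonneg ‖y.1‖, sq_nonneg y.2.1, sq_nonneg y.2.2]
  exact Prod.ext (norm_eq_zero.1 a) (Prod.ext b c)

/-- Three time parts in `ℝ²` satisfy a nontrivial relation. The same combination of the full vectors
has no time part, yet by orthogonality its square is nonpositive, so it vanishes. -/
theorem not_linearIndependent_of_nonpos {y : Fin 3 → LieSpace}
    (h : ∀ i j, i ≠ j → lieForm (y i) (y j) = 0) (hn : ∀ i, lieForm (y i) (y i) ≤ 0) :
    ¬ LinearIndependent ℝ y := by
  have h2 : ¬ LinearIndependent ℝ (fun i => (y i).2) := fun hi => by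
    have := hi.fintype_card_le_finrank
    simp at this
  rw [Fintype.not_linearIndependent_iff] at h2 ⊢
  obtain ⟨g, hg, hne⟩ := h2
  refine ⟨g, eq_zero_of_lieForm_self_nonpos ?_ ?_, hne⟩
  · have h01 := h 0 1 (by decide)
    have h02 := h 0 2 (by decide)
    have h12 := h 1 2 (by decide)
    simp only [Fin.sum_univ_three, lieForm_add_left, lieForm_add_right, lieForm_smul_left,
      lieForm_smul_right, h01, h02, h12, lieForm_comm (y 1) (y 0), lieForm_comm (y 2) (y 0),
      lieForm_comm (y 2) (y 1)]
    nlinarith [mul_nonneg (sq_nonneg (g 0)) (neg_nonneg.2 (hn 0)),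
      mul_nonneg (sq_nonneg (g 1)) (neg_nonneg.2 (hn 1)),
      mul_nonneg (sq_nonneg (g 2)) (neg_nonneg.2 (hn 2))]
  · rw [← hg, Prod.snd_sum]
    rfl

theorem not_linearIndependent_triple {a b c : LieSpace} (haa : lieForm a a ≤ 0)
    (hbb : lieForm b b ≤ 0) (hcc : lieForm c c ≤ 0) (hab : lieForm a b = 0)
    (hac : lieForm a c = 0) (hbc : lieForm b c = 0) : ¬ LinearIndependent ℝ ![a, b, c] := by
  apply not_linearIndependent_of_nonpos
  · intro i j hij
    fin_cases i <;> fin_cases j <;> simp_all [lieForm_comm]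
  · intro i
    fin_cases i <;> simpa

/-! ### Isotropic lines -/

theorem IsIsotropicLine.lieForm_eq_zero {L : Submodule ℝ LieSpace} (hL : IsIsotropicLine L)
    {y z : LieSpace} (hy : y ∈ L) (hz : z ∈ L) : lieForm y z = 0 := by
  have h := hL.2 _ (L.add_mem hy hz)
  rw [lieForm_add_left, lieForm_add_right, lieForm_add_right, hL.2 y hy, hL.2 z hz,
    lieForm_comm z y] at h
  linarith

theorem exists_mem_ne_zero_of_intersects {L M : Submodule ℝ LieSpace} (h : Intersects L M) :
    ∃ y, y ≠ 0 ∧ y ∈ L ∧ y ∈ M := by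
  obtain ⟨y, hy, h0⟩ := Submodule.exists_mem_ne_zero_of_ne_bot h
  exact ⟨y, h0, hy.1, hy.2⟩

theorem IsIsotropicLine.eq_span_pair {L : Submodule ℝ LieSpace} (hL : IsIsotropicLine L)
    {y z : LieSpace} (hy : y ∈ L) (hz : z ∈ L) (h : LinearIndependent ℝ ![y, z]) :
    L = Submodule.span ℝ {y, z} := by
  symm
  apply Submodule.eq_of_le_of_finrank_le
  · rw [Submodule.span_le]
    rintro w (rfl | rfl) <;> assumption
  · rw [hL.1]
    have hr : Set.range ![y, z] = {y, z} := by
      rw [Matrix.range_cons, Matrix.range_cons, Matrix.range_empty, Set.union_empty, Set.insert_eq]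
    rw [← hr, finrank_span_eq_card h, Fintype.card_fin]

/-- Two distinct isotropic lines have at most one point in common. -/
theorem IsIsotropicLine.exists_smul_eq {L M : Submodule ℝ LieSpace} (hL : IsIsotropicLine L)
    (hM : IsIsotropicLine M) (hne : L ≠ M) {y z : LieSpace} (hy0 : y ≠ 0)
    (hyL : y ∈ L) (hyM : y ∈ M) (hzL : z ∈ L) (hzM : z ∈ M) : ∃ a : ℝ, a • y = z := by
  by_contra! h
  have hi := (LinearIndependent.pair_iff' hy0).2 h
  exact hne ((hL.eq_span_pair hyL hzL hi).trans (hM.eq_span_pair hyM hzM hi).symm)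

/-- Pairwise intersecting isotropic lines that are not all equal are concurrent. -/
theorem exists_common_point {ι : Type*} {M : ι → Submodule ℝ LieSpace}
    (hM : ∀ j, IsIsotropicLine (M j)) (hint : ∀ j k, Intersects (M j) (M k))
    {j k : ι} (hne : M j ≠ M k) : ∃ p, p ≠ 0 ∧ ∀ m, p ∈ M m := by
  obtain ⟨p, hp0, hpj, hpk⟩ := exists_mem_ne_zero_of_intersects (hint j k)
  refine ⟨p, hp0, fun m => ?_⟩
  obtain ⟨a, ha0, ham, haj⟩ := exists_mem_ne_zero_of_intersects (hint m j)
  obtain ⟨b, hb0, hbm, hbk⟩ := exists_mem_ne_zero_of_intersects (hint m k)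
  by_contra hpm
  -- If `M m` misses `p`, it meets `M j` and `M k` in `a` and `b`, and `p, a, b` are mutually
  -- orthogonal, hence dependent. As `p ∉ M m`, the relation puts `a` on the line of `b`, so `M j`
  -- and `M k` share `a` as well as `p`; then `p` is a multiple of `a`.
  have key := not_linearIndependent_triple ((hM j).2 p hpj).le ((hM m).2 a ham).le
    ((hM m).2 b hbm).le ((hM j).lieForm_eq_zero hpj haj) ((hM k).lieForm_eq_zero hpk hbk)
    ((hM m).lieForm_eq_zero ham hbm)
  rw [Fintype.not_linearIndependent_iff] at key
  obtain ⟨g, hg, hne'⟩ := key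
  simp only [Fin.sum_univ_three, Matrix.cons_val] at hg
  have hg0 : g 0 = 0 := by
    by_contra h0
    refine hpm (((M m).smul_mem_iff h0).1 ?_)
    rw [show g 0 • p = -(g 1 • a + g 2 • b) by rw [eq_neg_iff_add_eq_zero, ← hg]; abel]
    exact (M m).neg_mem ((M m).add_mem ((M m).smul_mem _ ham) ((M m).smul_mem _ hbm))
  rw [hg0, zero_smul, zero_add] at hg
  have hg1 : g 1 ≠ 0 := by
    intro h1
    rw [h1, zero_smul, zero_add] at hg
    have h2 := (smul_eq_zero.1 hg).resolve_right hb0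
    obtain ⟨i, hi⟩ := hne'
    fin_cases i <;> simp_all
  have hak : a ∈ M k := by
    refine ((M k).smul_mem_iff hg1).1 ?_
    rw [eq_neg_of_add_eq_zero_left hg]
    exact (M k).neg_mem ((M k).smul_mem _ hbk)
  obtain ⟨c, rfl⟩ := (hM j).exists_smul_eq (hM k) hne ha0 haj hak hpj hpk
  exact hpm ((M m).smul_mem _ ham)

/-- A family of pairwise intersecting isotropic lines that spans at least a projective
three-space is concurrent. -/
theorem exists_common_point_of_finrank {ι : Type*} [Nonempty ι] {M : ι → Submodule ℝ LieSpace}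
    (hM : ∀ j, IsIsotropicLine (M j)) (hint : ∀ j k, Intersects (M j) (M k))
    (hs : 4 ≤ Module.finrank ℝ (⨆ j, M j : Submodule ℝ LieSpace)) :
    ∃ p, p ≠ 0 ∧ ∀ m, p ∈ M m := by
  by_cases h : ∀ j k, M j = M k
  · exfalso
    have j := Classical.arbitrary ι
    have : (⨆ j, M j) = M j := by
      simp only [h _ j, ciSup_const]
    rw [this, (hM j).1] at hs
    omega
  · push Not at h
    obtain ⟨j, k, hjk⟩ := h
    exact exists_common_point hM hint hjk

/-! ### Dupin cyclides from a pair of conics -/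

/-- A parametrization of the light cone of a three-dimensional Lorentzian subspace by a circle. -/
structure IsConeCircle (c : ℝ → LieSpace) : Prop where
  smooth : ContDiff ℝ ∞ c
  form : ∀ u u', lieForm (c u) (c u') = Real.cos (u - u') - 1
  form_deriv : ∀ u, lieForm (deriv c u) (deriv c u) = 1
  periodic : Function.Periodic c (2 * Real.pi)

/-- The determinant of the last two coordinates of `y` and `z`. -/
def timeDet (y z : LieSpace) : ℝ := y.2.1 * z.2.2 - y.2.2 * z.2.1

/-- The base point of the contact element spanned by `y` and `z`. -/
def basePoint (y z : LieSpace) : E4 := (timeDet y z)⁻¹ • (z.2.2 • y.1 - y.2.2 • z.1)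

/-- The unit normal of the contact element spanned by `y` and `z`. -/
def unitNormal (y z : LieSpace) : E4 := (timeDet y z)⁻¹ • (y.2.1 • z.1 - z.2.1 • y.1)

/-- Cramer's rule: `basePoint` and `unitNormal` solve the 2×2 system formed by this equation and the
one for `z`. -/
theorem fst_eq_left {y z : LieSpace} (h : timeDet y z ≠ 0) :
    y.1 = y.2.1 • basePoint y z + y.2.2 • unitNormal y z := by
  have h1 : y.1 = (timeDet y z)⁻¹ • (timeDet y z • y.1) := by
    rw [smul_smul, inv_mul_cancel₀ h, one_smul]
  rw [basePoint, unitNormal, smul_comm, smul_comm y.2.2, ← smul_add]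
  nth_rewrite 1 [h1]
  congr 1
  rw [timeDet]
  module

theorem fst_eq_right {y z : LieSpace} (h : timeDet y z ≠ 0) :
    z.1 = z.2.1 • basePoint y z + z.2.2 • unitNormal y z := by
  have h1 : z.1 = (timeDet y z)⁻¹ • (timeDet y z • z.1) := by
    rw [smul_smul, inv_mul_cancel₀ h, one_smul]
  rw [basePoint, unitNormal, smul_comm, smul_comm z.2.2, ← smul_add]
  nth_rewrite 1 [h1]
  congr 1
  rw [timeDet]
  module

theorem mem_contactElement_iff {x n : E4} {y : LieSpace} :
    y ∈ contactElement x n ↔ y.1 = y.2.1 • x + y.2.2 • n := by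
  rw [contactElement, Submodule.mem_span_pair]
  constructor
  · rintro ⟨a, b, rfl⟩
    simp [orientedSphere]
  · intro h
    refine ⟨y.2.1, y.2.2, ?_⟩
    refine Prod.ext ?_ (Prod.ext ?_ ?_) <;> simp [orientedSphere, h]

theorem contactElement_eq_span_pair {y z : LieSpace} (h : timeDet y z ≠ 0) :
    contactElement (basePoint y z) (unitNormal y z) = Submodule.span ℝ {y, z} := by
  apply le_antisymm
  · rw [contactElement, Submodule.span_le]
    rintro w (rfl | rfl) <;> rw [SetLike.mem_coe, Submodule.mem_span_pair]
    · refine ⟨(timeDet y z)⁻¹ * z.2.2, -((timeDet y z)⁻¹ * y.2.2), ?_⟩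
      refine Prod.ext ?_ (Prod.ext ?_ ?_)
      · simp [orientedSphere, basePoint]; module
      · simp [orientedSphere]; field_simp; rw [timeDet]; ring
      · simp [orientedSphere]; ring
    · refine ⟨-((timeDet y z)⁻¹ * z.2.1), (timeDet y z)⁻¹ * y.2.1, ?_⟩
      refine Prod.ext ?_ (Prod.ext ?_ ?_)
      · simp [orientedSphere, unitNormal]; module
      · simp [orientedSphere]; ring
      · simp [orientedSphere]; field_simp; rw [timeDet]; ring
  · rw [Submodule.span_le]
    rintro w (rfl | rfl) <;> rw [SetLike.mem_coe, mem_contactElement_iff]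
    · exact fst_eq_left h
    · exact fst_eq_right h

/-- Derivative of an expansion in base point and normal along a curve of spheres that depends
only on one parameter. -/
theorem fderiv_expansion {x n : ℝ × ℝ → E4} (hx : Differentiable ℝ x) (hn : Differentiable ℝ n)
    {c : ℝ → LieSpace} (hc : Differentiable ℝ c) (φ : ℝ × ℝ →L[ℝ] ℝ)
    (h : ∀ p, (c (φ p)).1 = (c (φ p)).2.1 • x p + (c (φ p)).2.2 • n p) (p w : ℝ × ℝ) :
    φ w • (deriv c (φ p)).1 =
      (c (φ p)).2.1 • fderiv ℝ x p w + (c (φ p)).2.2 • fderiv ℝ n p w +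
      φ w • ((deriv c (φ p)).2.1 • x p + (deriv c (φ p)).2.2 • n p) := by
  have hcφ : HasFDerivAt (fun p => c (φ p))
      ((ContinuousLinearMap.toSpanSingleton ℝ (deriv c (φ p))).comp φ) p :=
    (hc (φ p)).hasDerivAt.hasFDerivAt.comp p φ.hasFDerivAt
  have h1 := hcφ.fst
  have h21 := hcφ.snd.fst
  have h22 := hcφ.snd.snd
  have hr := (h21.smul (hx p).hasFDerivAt).add (h22.smul (hn p).hasFDerivAt)
  have h1' := h1.congr_of_eventuallyEq (f₁ := fun p => (c (φ p)).2.1 • x p + (c (φ p)).2.2 • n p)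
    (Filter.Eventually.of_forall fun p => (h p).symm)
  have := congrArg (fun f => f w) (h1'.unique hr)
  simp at this
  rw [this]
  module

theorem IsConeCircle.ne_zero {c : ℝ → LieSpace} (hc : IsConeCircle c) (u : ℝ) : c u ≠ 0 := by
  intro h
  have := hc.form u (u - Real.pi)
  rw [h, lieForm_zero_left] at this
  norm_num at this

theorem IsConeCircle.form_self {c : ℝ → LieSpace} (hc : IsConeCircle c) (u : ℝ) :
    lieForm (c u) (c u) = 0 := by
  simp [hc.form]

/-- A zero determinant yields combinations of `p u` and `q v` without time part. They are isotropic,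
hence zero, and the coefficients of `p u`, which are the time coordinates of `q v`, must vanish. -/
theorem IsConeCircle.timeDet_ne_zero {p q : ℝ → LieSpace} (hp : IsConeCircle p)
    (hq : IsConeCircle q) (hpq : ∀ u v, lieForm (p u) (q v) = 0) (u v : ℝ) :
    timeDet (p u) (q v) ≠ 0 := by
  intro h
  rw [timeDet] at h
  -- a combination of the two spheres without time part vanishes
  have key : ∀ a b : ℝ, a • (p u).2 + b • (q v).2 = 0 → a = 0 := by
    intro a b hab
    have h0 : a • p u + b • q v = 0 := by
      apply eq_zero_of_lieForm_self_nonpos _ hab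
      simp [lieForm_add_left, lieForm_add_right, lieForm_smul_left, lieForm_smul_right,
        hp.form_self, hq.form_self, hpq, lieForm_comm (q v) (p u)]
    -- The opposite point of the circle has product `-2` with `p u` and `0` with `q v`.
    have h1 := congrArg (lieForm (p (u - Real.pi))) h0
    rw [lieForm_zero_right, lieForm_add_right, lieForm_smul_right, lieForm_smul_right, hpq,
      hp.form] at h1
    norm_num at h1
    exact h1
  have h1 : (q v).2.1 = 0 := by
    apply key _ (-(p u).2.1)
    ext <;> simp <;> linarith
  have h2 : (q v).2.2 = 0 := by
    apply key _ (-(p u).2.2)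
    ext <;> simp <;> linarith
  exact hq.ne_zero v (eq_zero_of_lieForm_self_nonpos (hq.form_self v).le (Prod.ext h1 h2))

/-- Two orthogonal light cones define a Dupin cyclide. -/
theorem isDupinCyclide_of_isConeCircle {p q : ℝ → LieSpace} (hp : IsConeCircle p)
    (hq : IsConeCircle q) (hpq : ∀ u v, lieForm (p u) (q v) = 0) :
    IsDupinCyclide (fun w => basePoint (p w.1) (q w.2)) (fun w => unitNormal (p w.1) (q w.2)) := by
  have hD : ∀ u v, timeDet (p u) (q v) ≠ 0 := hp.timeDet_ne_zero hq hpq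
  set x : ℝ × ℝ → E4 := fun w => basePoint (p w.1) (q w.2) with hxdef
  set n : ℝ × ℝ → E4 := fun w => unitNormal (p w.1) (q w.2) with hndef
  have hp1 : ContDiff ℝ ∞ (fun w : ℝ × ℝ => p w.1) := hp.smooth.comp contDiff_fst
  have hq1 : ContDiff ℝ ∞ (fun w : ℝ × ℝ => q w.2) := hq.smooth.comp contDiff_snd
  have hDinv : ContDiff ℝ ∞ (fun w : ℝ × ℝ => (timeDet (p w.1) (q w.2))⁻¹) :=
    ContDiff.inv ((hp1.snd.fst.mul hq1.snd.snd).sub (hp1.snd.snd.mul hq1.snd.fst))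
      fun w => hD w.1 w.2
  have hx : ContDiff ℝ ∞ x :=
    hDinv.smul ((hq1.snd.snd.smul hp1.fst).sub (hp1.snd.snd.smul hq1.fst))
  have hn : ContDiff ℝ ∞ n :=
    hDinv.smul ((hp1.snd.fst.smul hq1.fst).sub (hq1.snd.fst.smul hp1.fst))
  have hxd : Differentiable ℝ x := hx.differentiable (by simp)
  have hnd : Differentiable ℝ n := hn.differentiable (by simp)
  have hpe : ∀ w : ℝ × ℝ, (p w.1).1 = (p w.1).2.1 • x w + (p w.1).2.2 • n w :=
    fun w => fst_eq_left (hD _ _)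
  have hqe : ∀ w : ℝ × ℝ, (q w.2).1 = (q w.2).2.1 • x w + (q w.2).2.2 • n w :=
    fun w => fst_eq_right (hD _ _)
  have hpd := fderiv_expansion hxd hnd (hp.smooth.differentiable (by simp))
    (ContinuousLinearMap.fst ℝ ℝ ℝ) hpe
  have hqd := fderiv_expansion hxd hnd (hq.smooth.differentiable (by simp))
    (ContinuousLinearMap.snd ℝ ℝ ℝ) hqe
  simp only [ContinuousLinearMap.coe_fst', ContinuousLinearMap.coe_snd'] at hpd hqd
  -- orthonormality
  have hiso : ∀ w : ℝ × ℝ, ∀ y ∈ contactElement (x w) (n w), ∀ z ∈ contactElement (x w) (n w),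
      lieForm y z = 0 := by
    intro w y hy z hz
    rw [hxdef, hndef, contactElement_eq_span_pair (hD w.1 w.2), Submodule.mem_span_pair] at hy hz
    obtain ⟨a, b, rfl⟩ := hy
    obtain ⟨c, d, rfl⟩ := hz
    simp [lieForm_add_left, lieForm_add_right, lieForm_smul_left, lieForm_smul_right,
        hp.form_self, hq.form_self, hpq, lieForm_comm (q w.2) (p w.1)]
  have hX : ∀ w, (x w, (1 : ℝ), (0 : ℝ)) ∈ contactElement (x w) (n w) := fun w => by
    simp [mem_contactElement_iff]
  have hN : ∀ w, (n w, (0 : ℝ), (1 : ℝ)) ∈ contactElement (x w) (n w) := fun w => by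
    simp [mem_contactElement_iff]
  have hxx : ∀ w, inner ℝ (x w) (x w) = (1 : ℝ) := fun w => by
    have := hiso w _ (hX w) _ (hX w)
    simp only [lieForm] at this
    linarith
  have hnn : ∀ w, inner ℝ (n w) (n w) = (1 : ℝ) := fun w => by
    have := hiso w _ (hN w) _ (hN w)
    simp only [lieForm] at this
    linarith
  have hxn : ∀ w, inner ℝ (x w) (n w) = (0 : ℝ) := fun w => by
    have := hiso w _ (hX w) _ (hN w)
    simp only [lieForm] at this
    linarith
  -- derivatives of these relations
  have hdiff : ∀ f g : ℝ × ℝ → E4, Differentiable ℝ f → Differentiable ℝ g → ∀ a : ℝ,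
      (∀ w, inner ℝ (f w) (g w) = a) → ∀ w e,
      inner ℝ (f w) (fderiv ℝ g w e) + inner ℝ (fderiv ℝ f w e) (g w) = (0 : ℝ) := by
    intro f g hf hg a h w e
    rw [← fderiv_inner_apply ℝ (hf w) (hg w), show (fun t => inner ℝ (f t) (g t)) = fun _ => a from
      funext h]
    simp
  have dxx : ∀ w e, inner ℝ (x w) (fderiv ℝ x w e) = (0 : ℝ) := fun w e => by
    have := hdiff x x hxd hxd 1 hxx w e
    rw [real_inner_comm (x w) (fderiv ℝ x w e)] at this
    linarith
  have dnn : ∀ w e, inner ℝ (n w) (fderiv ℝ n w e) = (0 : ℝ) := fun w e => by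
    have := hdiff n n hnd hnd 1 hnn w e
    rw [real_inner_comm (n w) (fderiv ℝ n w e)] at this
    linarith
  have dxn := hdiff x n hxd hnd 0 hxn
  -- a principal direction is tangent
  have tang : ∀ (a b : ℝ) w e, ¬ (a = 0 ∧ b = 0) →
      a • fderiv ℝ x w e + b • fderiv ℝ n w e = 0 →
      inner ℝ (fderiv ℝ x w e) (n w) = (0 : ℝ) := by
    intro a b w e hab h
    -- Pairing with `x` and `n` leaves `b⟨x, dn⟩ = 0` and `a⟨n, dx⟩ = 0`. The two products are
    -- opposite by `dxn`, so one nonzero coefficient suffices.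
    have h1 := congrArg (inner ℝ (x w)) h
    have h2 := congrArg (inner ℝ (n w)) h
    simp only [inner_add_right, real_inner_smul_right, dxx, dnn, inner_zero_right] at h1 h2
    have h3 := dxn w e
    rw [real_inner_comm (n w)] at h3 ⊢
    by_cases ha : a = 0
    · have hb : b ≠ 0 := fun hb => hab ⟨ha, hb⟩
      have : inner ℝ (x w) (fderiv ℝ n w e) = (0 : ℝ) := by
        simpa [hb] using h1
      linarith
    · simpa [ha] using h2
  have pnz : ∀ u, ¬ ((p u).2.1 = 0 ∧ (p u).2.2 = 0) := fun u h =>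
    hp.ne_zero u (eq_zero_of_lieForm_self_nonpos (hp.form_self u).le (Prod.ext h.1 h.2))
  have qnz : ∀ u, ¬ ((q u).2.1 = 0 ∧ (q u).2.2 = 0) := fun u h =>
    hq.ne_zero u (eq_zero_of_lieForm_self_nonpos (hq.form_self u).le (Prod.ext h.1 h.2))
  have prin1 : ∀ w : ℝ × ℝ, (q w.2).2.1 • fderiv ℝ x w (1, 0) + (q w.2).2.2 •
      fderiv ℝ n w (1, 0) = 0 := fun w => by
    simpa using (hqd w (1, 0)).symm
  have prin2 : ∀ w : ℝ × ℝ, (p w.1).2.1 • fderiv ℝ x w (0, 1) + (p w.1).2.2 •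
      fderiv ℝ n w (0, 1) = 0 := fun w => by
    simpa using (hpd w (0, 1)).symm
  refine ⟨⟨hx, hn, fun w => ?_, fun w => ?_, hxn, fun w e => ?_, fun w e hxe hne => ?_⟩, ?_, ?_⟩
  · have := real_inner_self_eq_norm_sq (x w)
    rw [hxx] at this
    nlinarith [norm_nonneg (x w)]
  · have := real_inner_self_eq_norm_sq (n w)
    rw [hnn] at this
    nlinarith [norm_nonneg (n w)]
  · have he : e = e.1 • ((1 : ℝ), (0 : ℝ)) + e.2 • ((0 : ℝ), (1 : ℝ)) := by ext <;> simp
    rw [he, map_add, map_smul, map_smul, inner_add_left, real_inner_smul_left,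
      real_inner_smul_left, tang _ _ w _ (qnz w.2) (prin1 w), tang _ _ w _ (pnz w.1) (prin2 w)]
    simp
  -- If `dx` and `dn` vanish on `e ≠ 0`, then `p'` or `q'` lies in the isotropic contact element,
  -- although its square is 1.
  · have h1 := hpd w e
    have h2 := hqd w e
    rw [hxe, hne, smul_zero, smul_zero, add_zero, zero_add] at h1 h2
    refine Prod.ext ?_ ?_
    · by_contra h0
      have hm := mem_contactElement_iff.2 (smul_right_injective _ h0 h1)
      have := hp.form_deriv w.1
      rw [hiso w _ hm _ hm] at this
      exact zero_ne_one this
    · by_contra h0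
      have hm := mem_contactElement_iff.2 (smul_right_injective _ h0 h2)
      have := hq.form_deriv w.2
      rw [hiso w _ hm _ hm] at this
      exact zero_ne_one this
  · intro w w'
    constructor
    · rintro ⟨h1, h2⟩
      have a1 := mem_contactElement_iff.2 (hpe w)
      have a2 := mem_contactElement_iff.2 (hqe w)
      have b1 := mem_contactElement_iff.2 (hpe w')
      have b2 := mem_contactElement_iff.2 (hqe w')
      rw [← h1, ← h2] at b1 b2
      -- Both `p`-spheres lie on one isotropic line, so `cos (u - u') = 1`; likewise for `q`.
      have c1 := hiso w _ a1 _ b1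
      have c2 := hiso w _ a2 _ b2
      rw [hp.form, sub_eq_zero, Real.cos_eq_one_iff] at c1
      rw [hq.form, sub_eq_zero, Real.cos_eq_one_iff] at c2
      obtain ⟨k, hk⟩ := c1
      obtain ⟨m, hm⟩ := c2
      refine ⟨k, m, Prod.ext ?_ ?_⟩
      · simp only [Prod.fst_add]; linarith
      · simp only [Prod.snd_add]; linarith
    · rintro ⟨k, m, rfl⟩
      have h1 : p (w'.1 + k * (2 * Real.pi)) = p w'.1 := hp.periodic.int_mul k _
      have h2 : q (w'.2 + m * (2 * Real.pi)) = q w'.2 := hq.periodic.int_mul m _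
      simp only [hxdef, hndef, Prod.fst_add, Prod.snd_add, h1, h2, and_self]
  -- The radii are arguments of the time parts of `q` and `p`; no continuity is required. Up to a
  -- factor, `sin (r₁ - r₂)` is `timeDet`.
  · have polar : ∀ y : LieSpace, ¬ (y.2.1 = 0 ∧ y.2.2 = 0) → ∃ ρ r : ℝ, ρ ≠ 0 ∧
        y.2.1 = ρ * Real.cos r ∧ y.2.2 = ρ * Real.sin r := by
      intro y hy
      set z : ℂ := ⟨y.2.1, y.2.2⟩ with hz
      refine ⟨‖z‖, z.arg, ?_, ?_, ?_⟩
      · rw [Ne, norm_eq_zero]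
        intro h
        exact hy ⟨congrArg Complex.re h, congrArg Complex.im h⟩
      · rw [Complex.norm_mul_cos_arg]
      · rw [Complex.norm_mul_sin_arg]
    choose ρ₁ r₁ hρ₁ hc₁ hs₁ using fun v => polar (q v) (qnz v)
    choose ρ₂ r₂ hρ₂ hc₂ hs₂ using fun u => polar (p u) (pnz u)
    refine ⟨fun w => r₁ w.2, fun w => r₂ w.1, fun w => ⟨by simp, ?_⟩, fun w => ⟨by simp, ?_⟩,
      fun w h => ?_, fun _ _ _ => rfl, fun _ _ _ => rfl⟩
    · have := prin1 w
      rw [hc₁, hs₁, mul_smul, mul_smul, ← smul_add] at this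
      exact (smul_eq_zero.1 this).resolve_left (hρ₁ _)
    · have := prin2 w
      rw [hc₂, hs₂, mul_smul, mul_smul, ← smul_add] at this
      exact (smul_eq_zero.1 this).resolve_left (hρ₂ _)
    · apply hD w.1 w.2
      rw [Real.sin_sub] at h
      rw [timeDet, hc₁, hs₁, hc₂, hs₂]
      linear_combination ρ₁ w.2 * ρ₂ w.1 * h

/-! ### Lorentz frames -/

/-- An orthonormal frame of a three-dimensional subspace of signature `(2,1)`. -/
structure IsLorentzFrame (e₁ e₂ t : LieSpace) : Prop where
  form₁₁ : lieForm e₁ e₁ = 1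
  form₂₂ : lieForm e₂ e₂ = 1
  form_tt : lieForm t t = -1
  form₁₂ : lieForm e₁ e₂ = 0
  form₁t : lieForm e₁ t = 0
  form₂t : lieForm e₂ t = 0

/-- The circle of light-like vectors with time coordinate one in a Lorentz frame. -/
def coneCircle (e₁ e₂ t : LieSpace) (u : ℝ) : LieSpace := Real.cos u • e₁ + Real.sin u • e₂ + t

theorem hasDerivAt_coneCircle (e₁ e₂ t : LieSpace) (u : ℝ) :
    HasDerivAt (coneCircle e₁ e₂ t) (-Real.sin u • e₁ + Real.cos u • e₂) u :=
  (((Real.hasDerivAt_cos u).smul_const e₁).add ((Real.hasDerivAt_sin u).smul_const e₂)).add_const t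

theorem IsLorentzFrame.isConeCircle {e₁ e₂ t : LieSpace} (h : IsLorentzFrame e₁ e₂ t) :
    IsConeCircle (coneCircle e₁ e₂ t) where
  smooth := ((Real.contDiff_cos.smul contDiff_const).add
    (Real.contDiff_sin.smul contDiff_const)).add contDiff_const
  form u u' := by
    simp only [coneCircle, lieForm_add_left, lieForm_add_right, lieForm_smul_left,
      lieForm_smul_right, h.form₁₁, h.form₂₂, h.form_tt, h.form₁₂, h.form₁t, h.form₂t,
      lieForm_comm e₂ e₁, lieForm_comm t e₁, lieForm_comm t e₂, Real.cos_sub]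
    ring
  form_deriv u := by
    rw [(hasDerivAt_coneCircle e₁ e₂ t u).deriv]
    simp only [lieForm_add_left, lieForm_add_right, lieForm_smul_left, lieForm_smul_right,
      h.form₁₁, h.form₂₂, h.form₁₂, lieForm_comm e₂ e₁]
    linear_combination Real.sin_sq_add_cos_sq u
  periodic u := by
    simp only [coneCircle, Real.cos_add_two_pi, Real.sin_add_two_pi]

theorem exists_eq_smul_coneCircle {e₁ e₂ t z : LieSpace} (h : IsLorentzFrame e₁ e₂ t)
    (hz0 : z ≠ 0) (hz : lieForm z z = 0) {a b c : ℝ} (habc : z = a • e₁ + b • e₂ + c • t) :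
    ∃ u ρ : ℝ, z = ρ • coneCircle e₁ e₂ t u := by
  have hq : a ^ 2 + b ^ 2 = c ^ 2 := by
    rw [habc] at hz
    simp only [lieForm_add_left, lieForm_add_right, lieForm_smul_left,
      lieForm_smul_right, h.form₁₁, h.form₂₂, h.form_tt, h.form₁₂, h.form₁t, h.form₂t,
      lieForm_comm e₂ e₁, lieForm_comm t e₁, lieForm_comm t e₂] at hz
    linarith
  have hc : c ≠ 0 := by
    rintro rfl
    have ha : a = 0 := by nlinarith [sq_nonneg a, sq_nonneg b]
    have hb : b = 0 := by nlinarith [sq_nonneg a, sq_nonneg b]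
    exact hz0 (by rw [habc, ha, hb]; simp)
  set ζ : ℂ := ⟨a / c, b / c⟩ with hζ
  have hn : ‖ζ‖ = 1 := by
    have h1 : ‖ζ‖ ^ 2 = 1 := by
      rw [Complex.sq_norm, Complex.normSq_mk]
      field_simp
      linarith
    nlinarith [norm_nonneg ζ]
  refine ⟨ζ.arg, c, ?_⟩
  have h1 := Complex.norm_mul_cos_arg ζ
  have h2 := Complex.norm_mul_sin_arg ζ
  rw [hn, one_mul] at h1 h2
  rw [coneCircle, h1, h2, habc, smul_add, smul_add, smul_smul, smul_smul, hζ,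
    mul_div_cancel₀ _ hc, mul_div_cancel₀ _ hc]

/-- Vectors orthogonal to one of two orthogonal Lorentz frames are spanned by the other one. -/
theorem IsLorentzFrame.eq_combination {e₁ e₂ t f₁ f₂ s z : LieSpace}
    (he : IsLorentzFrame e₁ e₂ t) (hf : IsLorentzFrame f₁ f₂ s)
    (hef : ∀ y ∈ ({e₁, e₂, t} : Set LieSpace), ∀ w ∈ ({f₁, f₂, s} : Set LieSpace),
      lieForm y w = 0)
    (hz : ∀ w ∈ ({f₁, f₂, s} : Set LieSpace), lieForm z w = 0) :
    z = lieForm z e₁ • e₁ + lieForm z e₂ • e₂ + (-lieForm z t) • t := by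
  simp only [Set.mem_insert_iff, Set.mem_singleton_iff, forall_eq_or_imp, forall_eq] at hef hz
  obtain ⟨⟨h1, h2, h3⟩, ⟨h4, h5, h6⟩, ⟨h7, h8, h9⟩⟩ := hef
  obtain ⟨z1, z2, z3⟩ := hz
  obtain ⟨e11, e22, ett, e12, e1t, e2t⟩ := he
  obtain ⟨f11, f22, fss, f12, f1s, f2s⟩ := hf
  -- The two frames together are an orthogonal basis, and the difference of the two sides is
  -- orthogonal to all of it.
  set b : Fin 6 → LieSpace := ![e₁, e₂, t, f₁, f₂, s] with hb
  have horth : ∀ i j, i < j → lieForm (b i) (b j) = 0 := by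
    intro i j hij
    fin_cases i <;> fin_cases j <;> first | assumption | exact absurd hij (by decide)
  have hne : ∀ i, lieForm (b i) (b i) ≠ 0 := by
    intro i
    fin_cases i <;> simp [*]
  have hind : LinearIndependent ℝ b := by
    apply LinearMap.BilinForm.linearIndependent_of_iIsOrtho (B := lieBilin) _ hne
    intro i j hij
    rcases lt_or_gt_of_ne hij with h | h
    · exact horth i j h
    · exact (lieForm_comm _ _).trans (horth j i h)
  have htop : Submodule.span ℝ (Set.range b) = ⊤ := by
    apply hind.span_eq_top_of_card_eq_finrank
    simp
  rw [← sub_eq_zero]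
  apply eq_zero_of_forall_lieForm
  have hle : Submodule.span ℝ (Set.range b) ≤ LinearMap.ker (lieBilin
      (z - (lieForm z e₁ • e₁ + lieForm z e₂ • e₂ + (-lieForm z t) • t))) := by
    rw [Submodule.span_le]
    rintro _ ⟨i, rfl⟩
    rw [SetLike.mem_coe, LinearMap.mem_ker, lieBilin_apply]
    fin_cases i <;> simp [-neg_smul, lieForm_sub_left, lieForm_add_left, lieForm_smul_left, *,
      lieForm_comm e₂ e₁, lieForm_comm t e₁, lieForm_comm t e₂]
  rw [htop] at hle
  exact fun y => hle (Submodule.mem_top (x := y))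

/-- Three isotropic vectors, no two of which are orthogonal, in the orthogonal complement of an
isotropic vector span a Lorentzian subspace. -/
theorem exists_isLorentzFrame {p₀ p₁ p₂ z : LieSpace} (h0 : lieForm p₀ p₀ = 0)
    (h1 : lieForm p₁ p₁ = 0) (h2 : lieForm p₂ p₂ = 0) (h01 : lieForm p₀ p₁ ≠ 0)
    (h20 : lieForm p₂ p₀ ≠ 0) (h21 : lieForm p₂ p₁ ≠ 0) (hz0 : z ≠ 0) (hz : lieForm z z = 0)
    (hz₀ : lieForm p₀ z = 0) (hz₁ : lieForm p₁ z = 0) (hz₂ : lieForm p₂ z = 0) :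
    ∃ e₁ e₂ t, IsLorentzFrame e₁ e₂ t ∧
      ∀ y ∈ ({e₁, e₂, t} : Set LieSpace), y ∈ Submodule.span ℝ {p₀, p₁, p₂} := by
  set S := Submodule.span ℝ {p₀, p₁, p₂} with hS
  have m0 : p₀ ∈ S := Submodule.subset_span (by simp)
  have m1 : p₁ ∈ S := Submodule.subset_span (by simp)
  have m2 : p₂ ∈ S := Submodule.subset_span (by simp)
  have hSz : ∀ y ∈ S, lieForm y z = 0 := by
    have : S ≤ LinearMap.ker (lieBilin z) := by
      rw [hS, Submodule.span_le]
      rintro y (rfl | rfl | rfl) <;>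
        rw [SetLike.mem_coe, LinearMap.mem_ker, lieBilin_apply, lieForm_comm] <;> assumption
    exact fun y hy => (lieForm_comm _ _).trans (this hy)
  -- With this scale `p₀ ± c • p₁` have squares `∓1`.
  obtain ⟨c, hc⟩ : ∃ c, c * lieForm p₀ p₁ = -1 / 2 := ⟨-1 / 2 / lieForm p₀ p₁, by field_simp⟩
  have hc0 : c ≠ 0 := by rintro rfl; norm_num at hc
  obtain ⟨t, ht⟩ : ∃ t, t = p₀ + c • p₁ := ⟨_, rfl⟩
  obtain ⟨e, he⟩ : ∃ e, e = p₀ - c • p₁ := ⟨_, rfl⟩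
  have h10 := lieForm_comm p₁ p₀
  have mt : t ∈ S := ht ▸ S.add_mem m0 (S.smul_mem _ m1)
  have me : e ∈ S := he ▸ S.sub_mem m0 (S.smul_mem _ m1)
  have htt : lieForm t t = -1 := by
    simp only [ht, lieForm_add_left, lieForm_add_right, lieForm_smul_left, lieForm_smul_right,
      h0, h1, h10]
    linear_combination 2 * hc
  have hee : lieForm e e = 1 := by
    simp only [he, lieForm_sub_left, lieForm_sub_right, lieForm_smul_left, lieForm_smul_right,
      h0, h1, h10]
    linear_combination -2 * hc
  have het : lieForm e t = 0 := by
    simp only [ht, he, lieForm_sub_left, lieForm_add_right, lieForm_smul_left,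
      lieForm_smul_right, h0, h1, h10]
    ring
  have hte : lieForm t e = 0 := (lieForm_comm _ _).trans het
  obtain ⟨w, hw⟩ : ∃ w, w = p₂ + lieForm p₂ t • t - lieForm p₂ e • e := ⟨_, rfl⟩
  have mw : w ∈ S := hw ▸ S.sub_mem (S.add_mem m2 (S.smul_mem _ mt)) (S.smul_mem _ me)
  have hwt : lieForm w t = 0 := by
    simp only [hw, lieForm_sub_left, lieForm_add_left, lieForm_smul_left, htt, het]
    ring
  have hwe : lieForm w e = 0 := by
    simp only [hw, lieForm_sub_left, lieForm_add_left, lieForm_smul_left, hee, hte]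
    ring
  -- The square is `⟨p₂, t⟩² - ⟨p₂, e⟩²`, which factors through `t + e = 2p₀` and `t - e = 2c p₁`.
  have hww : lieForm w w = 4 * c * lieForm p₂ p₀ * lieForm p₂ p₁ := by
    have : lieForm w w = lieForm w p₂ := by
      nth_rewrite 2 [hw]
      simp only [lieForm_sub_right, lieForm_add_right, lieForm_smul_right, hwt, hwe]
      ring
    rw [this, lieForm_comm, hw]
    simp only [lieForm_sub_right, lieForm_add_right, lieForm_smul_right, h2]
    simp only [ht, he, lieForm_sub_right, lieForm_add_right, lieForm_smul_right]
    ring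
  have hww0 : lieForm w w ≠ 0 := by
    rw [hww]; positivity
  -- Otherwise `t, w, z` would be three independent orthogonal vectors of nonpositive square.
  have hpos : 0 < lieForm w w := by
    by_contra hneg
    have key := not_linearIndependent_triple (a := t) (b := w) (c := z) (by linarith)
      (not_lt.1 hneg) hz.le ((lieForm_comm _ _).trans hwt) (hSz t mt) (hSz w mw)
    rw [Fintype.not_linearIndependent_iff] at key
    obtain ⟨g, hg, i, hi⟩ := key
    simp only [Fin.sum_univ_three, Matrix.cons_val] at hg
    have g0 : g 0 = 0 := by
      have := congrArg (lieForm t) hg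
      simpa [lieForm_add_right, lieForm_smul_right, hSz t mt, htt, lieForm_comm t w, hwt,
        lieForm_zero_right] using this
    have g1 : g 1 = 0 := by
      have := congrArg (lieForm w) hg
      simpa [lieForm_add_right, lieForm_smul_right, hSz w mw, hwt, hww0,
        lieForm_zero_right] using this
    have g2 : g 2 = 0 := by
      simpa [g0, g1, hz0] using hg
    fin_cases i <;> simp_all
  refine ⟨e, (Real.sqrt (lieForm w w))⁻¹ • w, t, ⟨hee, ?_, htt, ?_, het, ?_⟩, ?_⟩
  · rw [lieForm_smul_left, lieForm_smul_right, ← mul_assoc, ← mul_inv,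
      Real.mul_self_sqrt hpos.le, inv_mul_cancel₀ hww0]
  · rw [lieForm_smul_right, lieForm_comm e, hwe, mul_zero]
  · rw [lieForm_smul_left, hwt, mul_zero]
  · rintro y (rfl | rfl | rfl)
    exacts [me, S.smul_mem _ mw, mt]

/-- Were `a ⊥ b`, their span would be a maximal isotropic subspace, which would contain every `q j`
and bound the rank by two. -/
theorem lieForm_ne_zero_of_linearIndependent {ι : Type*} {a b : LieSpace} {q : ι → LieSpace}
    (ha : lieForm a a = 0) (hb : lieForm b b = 0) (hab : LinearIndependent ℝ ![a, b])
    (hq : ∀ j, lieForm (q j) (q j) = 0) (haq : ∀ j, lieForm a (q j) = 0)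
    (hbq : ∀ j, lieForm b (q j) = 0)
    (hs : 3 ≤ Module.finrank ℝ (Submodule.span ℝ (Set.range q))) : lieForm a b ≠ 0 := by
  intro h
  have hle : Submodule.span ℝ (Set.range q) ≤ Submodule.span ℝ (Set.range ![a, b]) := by
    rw [Submodule.span_le]
    rintro _ ⟨j, rfl⟩
    by_contra hj
    refine not_linearIndependent_triple (hq j).le ha.le hb.le ((lieForm_comm _ _).trans (haq j))
      ((lieForm_comm _ _).trans (hbq j)) h ?_
    exact linearIndependent_finCons.2 ⟨hab, hj⟩
  have := Submodule.finrank_mono hle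
  rw [finrank_span_eq_card hab, Fintype.card_fin] at this
  omega

/-- Of two orthogonal families of isotropic vectors of rank at least three, the first one spans
a Lorentzian subspace. -/
theorem exists_isLorentzFrame_of_finrank {ι κ : Type*} {p : ι → LieSpace} {q : κ → LieSpace}
    (hp : ∀ i, lieForm (p i) (p i) = 0) (hq : ∀ j, lieForm (q j) (q j) = 0)
    (hpq : ∀ i j, lieForm (p i) (q j) = 0)
    (hps : 3 ≤ Module.finrank ℝ (Submodule.span ℝ (Set.range p)))
    (hqs : 3 ≤ Module.finrank ℝ (Submodule.span ℝ (Set.range q))) :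
    ∃ e₁ e₂ t, IsLorentzFrame e₁ e₂ t ∧
      ∀ y ∈ ({e₁, e₂, t} : Set LieSpace), y ∈ Submodule.span ℝ (Set.range p) := by
  obtain ⟨f, hf, -, hfi⟩ := Submodule.exists_fun_fin_finrank_span_eq ℝ (Set.range p)
  set g : Fin 3 → LieSpace := f ∘ Fin.castLE hps with hg
  have hgi : LinearIndependent ℝ g := hfi.comp _ (Fin.castLE_injective hps)
  have hgp : ∀ a, g a ∈ Set.range p := fun a => hf _
  have hgg : ∀ a, lieForm (g a) (g a) = 0 := fun a => by
    obtain ⟨i, hi⟩ := hgp a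
    rw [← hi, hp]
  have hgq : ∀ a j, lieForm (g a) (q j) = 0 := fun a j => by
    obtain ⟨i, hi⟩ := hgp a
    rw [← hi, hpq]
  have hne : ∀ a b, a ≠ b → lieForm (g a) (g b) ≠ 0 := by
    intro a b hab
    refine lieForm_ne_zero_of_linearIndependent (hgg a) (hgg b) ?_ hq (hgq a) (hgq b) hqs
    have := hgi.comp ![a, b] (by
      intro i j hij
      fin_cases i <;> fin_cases j <;> simp_all [eq_comm])
    convert this using 1
    ext i : 1
    fin_cases i <;> rfl
  obtain ⟨k, hk⟩ : ∃ k, q k ≠ 0 := by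
    by_contra! h
    have : Submodule.span ℝ (Set.range q) = ⊥ := by
      rw [Submodule.span_eq_bot]
      rintro _ ⟨j, rfl⟩
      exact h j
    rw [this, finrank_bot] at hqs
    omega
  obtain ⟨e₁, e₂, t, he, hmem⟩ := exists_isLorentzFrame (hgg 0) (hgg 1) (hgg 2)
    (hne 0 1 (by decide)) (hne 2 0 (by decide)) (hne 2 1 (by decide)) hk (hq k) (hgq 0 k)
    (hgq 1 k) (hgq 2 k)
  refine ⟨e₁, e₂, t, he, fun y hy => Submodule.span_mono ?_ (hmem y hy)⟩
  rintro z (rfl | rfl | rfl) <;> exact hgp _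

theorem lieForm_eq_zero_of_mem_span {A B : Set LieSpace}
    (h : ∀ y ∈ A, ∀ z ∈ B, lieForm y z = 0) {y z : LieSpace} (hy : y ∈ Submodule.span ℝ A)
    (hz : z ∈ Submodule.span ℝ B) : lieForm y z = 0 := by
  have h1 : ∀ y ∈ A, Submodule.span ℝ B ≤ LinearMap.ker (lieBilin y) := fun y hy => by
    rw [Submodule.span_le]
    exact fun z hz => h y hy z hz
  have h2 : Submodule.span ℝ A ≤ LinearMap.ker (lieBilin z) := by
    rw [Submodule.span_le]
    exact fun y hy => (lieForm_comm _ _).trans (h1 y hy hz)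
  exact (lieForm_comm _ _).trans (h2 hy)

/-! ### The congruence -/

/-- Dropping the common point `q` lowers the rank by at most one. -/
theorem three_le_finrank_span_range {ι : Type*} {M : ι → Submodule ℝ LieSpace} {p : ι → LieSpace}
    {q : LieSpace} (hM : ∀ i, M i = Submodule.span ℝ {p i, q})
    (hs : 4 ≤ Module.finrank ℝ (⨆ i, M i : Submodule ℝ LieSpace)) :
    3 ≤ Module.finrank ℝ (Submodule.span ℝ (Set.range p)) := by
  have hle : (⨆ i, M i) ≤ Submodule.span ℝ (Set.range p) ⊔ Submodule.span ℝ {q} := by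
    refine iSup_le fun i => ?_
    rw [hM i, Submodule.span_insert]
    exact sup_le_sup_right (Submodule.span_mono (by simp)) _
  have h1 := Submodule.finrank_mono hle
  have h2 := Submodule.finrank_add_le_finrank_add_finrank (Submodule.span ℝ (Set.range p))
    (Submodule.span ℝ {q})
  have h3 := finrank_span_le_card (R := ℝ) ({q} : Set LieSpace)
  simp only [Set.toFinset_singleton, Finset.card_singleton] at h3
  omega

end LieSphere

end

theorem mainTheorem10 (l : ℤ → ℤ → Submodule ℝ LieSphere.LieSpace)
    (hl : LieSphere.IsMultiLineCongruence l) (hgen : LieSphere.IsGeneric l) :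
    ∃ x n : ℝ × ℝ → LieSphere.E4, LieSphere.IsDupinCyclide x n ∧
      ∃ u v : ℤ → ℝ, ∀ i j : ℤ,
        l i j = LieSphere.contactElement (x (u i, v j)) (n (u i, v j)) := by
  open LieSphere in
  choose p hp0 hpm using fun i => exists_common_point_of_finrank (hl.isotropic i)
    (fun j k => (hl.intersects i i j k).2) (hgen.span_snd i)
  choose q hq0 hqm using fun j => exists_common_point_of_finrank (fun i => hl.isotropic i j)
    (fun i k => (hl.intersects i k j j).1) (hgen.span_fst j)
  have hlpq : ∀ i j, l i j = Submodule.span ℝ {p i, q j} := by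
    intro i j
    refine (hl.isotropic i j).eq_span_pair (hpm i j) (hqm j i) ?_
    rw [LinearIndependent.pair_iff' (hp0 i)]
    -- Proportional `p i` and `q j` would give a point excluded by (b).
    intro a ha
    apply hq0 j
    rw [← Submodule.mem_bot ℝ, ← hgen.no_common_point i j]
    refine ⟨(Submodule.mem_iInf _).2 fun j' => ?_, (Submodule.mem_iInf _).2 fun i' => hqm j i'⟩
    exact ha ▸ (l i j').smul_mem a (hpm i j')
  have hpp : ∀ i, lieForm (p i) (p i) = 0 := fun i => (hl.isotropic i 0).2 _ (hpm i 0)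
  have hqq : ∀ j, lieForm (q j) (q j) = 0 := fun j => (hl.isotropic 0 j).2 _ (hqm j 0)
  have hpq : ∀ i j, lieForm (p i) (q j) = 0 := fun i j =>
    (hl.isotropic i j).lieForm_eq_zero (hpm i j) (hqm j i)
  have hqp : ∀ j i, lieForm (q j) (p i) = 0 := fun j i => (lieForm_comm _ _).trans (hpq i j)
  -- The lines `l i 0` all pass through `q 0`, so their span controls the rank of the `p i`.
  have hps := three_le_finrank_span_range (fun i => hlpq i 0) (hgen.span_fst 0)
  have hqs := three_le_finrank_span_range
    (fun j => (hlpq 0 j).trans (by rw [Set.pair_comm])) (hgen.span_snd 0)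
  obtain ⟨e₁, e₂, t, he, heS⟩ := exists_isLorentzFrame_of_finrank hpp hqq hpq hps hqs
  obtain ⟨f₁, f₂, s, hf, hfS⟩ := exists_isLorentzFrame_of_finrank hqq hpp hqp hqs hps
  have hspan : ∀ y ∈ Submodule.span ℝ (Set.range p), ∀ z ∈ Submodule.span ℝ (Set.range q),
      lieForm y z = 0 := fun y hy z hz => lieForm_eq_zero_of_mem_span (by
    rintro _ ⟨i, rfl⟩ _ ⟨j, rfl⟩
    exact hpq i j) hy hz
  have hef : ∀ y ∈ ({e₁, e₂, t} : Set LieSpace), ∀ w ∈ ({f₁, f₂, s} : Set LieSpace),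
      lieForm y w = 0 := fun y hy w hw => hspan y (heS y hy) w (hfS w hw)
  have hfe : ∀ y ∈ ({f₁, f₂, s} : Set LieSpace), ∀ w ∈ ({e₁, e₂, t} : Set LieSpace),
      lieForm y w = 0 := fun y hy w hw => (lieForm_comm _ _).trans (hef w hw y hy)
  choose u ρ hu using fun i => exists_eq_smul_coneCircle he (hp0 i) (hpp i)
    (he.eq_combination hf hef fun w hw => hspan _ (Submodule.subset_span ⟨i, rfl⟩) w (hfS w hw))
  choose v σ hv using fun j => exists_eq_smul_coneCircle hf (hq0 j) (hqq j)
    (hf.eq_combination he hfe fun w hw => (lieForm_comm _ _).trans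
      (hspan w (heS w hw) _ (Submodule.subset_span ⟨j, rfl⟩)))
  have hcc : ∀ a b, lieForm (coneCircle e₁ e₂ t a) (coneCircle f₁ f₂ s b) = 0 := by
    simp only [Set.mem_insert_iff, Set.mem_singleton_iff, forall_eq_or_imp, forall_eq] at hef
    intro a b
    simp [coneCircle, lieForm_add_left, lieForm_add_right, lieForm_smul_left, lieForm_smul_right,
      hef]
  refine ⟨_, _, isDupinCyclide_of_isConeCircle he.isConeCircle hf.isConeCircle hcc, u, v,
    fun i j => ?_⟩
  rw [contactElement_eq_span_pair (he.isConeCircle.timeDet_ne_zero hf.isConeCircle hcc _ _),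
    hlpq i j]
  have hρ : ρ i ≠ 0 := fun h => hp0 i (by rw [hu i, h, zero_smul])
  have hσ : σ j ≠ 0 := fun h => hq0 j (by rw [hv j, h, zero_smul])
  rw [hu i, hv j, Submodule.span_insert, Submodule.span_insert,
    Submodule.span_singleton_smul_eq (IsUnit.mk0 _ hρ),
    Submodule.span_singleton_smul_eq (IsUnit.mk0 _ hσ)]
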